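/- Corollary (band-connected RIS). Let $K,N_T,N_I\ge 1$ and $N_1,\dots,N_K\ge 1$ be integers, let $Z_0>0$, and put $$D=\min\Big\{\sum_{k=1}^K N_k,\;N_T\Big\},\qquad L=\min\Big\{D,\frac{N_I}{2}\Big\},\qquad q=2L-1 .$$ For a real symmetric $N_I\times N_I$ matrix $\mathbf B$ (the susceptance matrix) let $\boldsymbol\Theta(\mathbf B)=(\mathbf I+\mathrm i Z_0\mathbf B)^{-1}(\mathbf I-\mathrm i Z_0\mathbf B)$. For channels $\mathbf H_{d,k}\in\mathbb C^{N_k\times N_T}$, $\mathbf H_{r,k}\in\mathbb C^{N_k\times N_I}$ $(1\le k\le K)$ and $\mathbf G\in\mathbb C^{N_I\times N_T}$, let $\mathbf H_{\mathrm{eff}}(\boldsymbol\Theta)\in\mathbb C^{(\sum_k N_k)\times N_T}$ be the matrix obtained by stacking the blocks $\mathbf H_{d,k}+\mathbf H_{r,k}\boldsymbol\Theta\mathbf G$, $k=1,\dots,K$. For integers $d_1,\dots,d_K\ge 0$, a set $\mathcal W\subseteq\mathbb C^{N_T\times\sum_k d_k}$, a utility $F(\mathbf W,\mathbf H)\in[-\infty,\infty]$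 and a set $\mathcal B$ of real $N_I\times N_I$ matrices, let $$P(\mathcal B)=\sup\{F(\mathbf W,\mathbf H_{\mathrm{eff}}(\boldsymbol\Theta(\mathbf B))) : \mathbf W\in\mathcal W,\ \mathbf B=\mathbf B^T,\ \mathbf B\in\mathcal B\}.$$ The fully-connected RIS has $\mathcal B=\mathbb R^{N_I\times N_I}$, with value $P_{\mathrm{fully}}$. The band-connected RIS of band width $q$ has $\mathcal B=\mathcal B_q=\{\mathbf B: B_{n,m}=0\text{ if }|m-n|>q\}$, with value $P_{\mathrm{band}}$. The $q$-step path graph has vertices $V_1,\dots,V_{N_I}$, and $V_n,V_m$ $(n\neq m)$ are adjacent iff $|m-n|\le q$. Then: 1. $\mathcal B_q$ is exactly the set of matrices whose off-diagonal entries vanish outside the edges of the $q$-step path graph, and the adjacency matrix $\mathbf A$ of this graph can be written as $\mathbf A=\mathbf P\bar{\mathbf A}\mathbf P^T$ with the permutation matrix $\mathbf P=\mathbf I$ and a matrix $\bar{\mathbf A}$ satisfying $$\sum_{m=n+1}^{N_I}\bar{\mathbf A}(n,m)=\min\{2L-1,\;N_I-n\},\qquad 1\le n\le N_I-1 .$$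 2. For Lebesgue-almost every $(\mathbf H_{r,1},\dots,\mathbf H_{r,K},\mathbf G)$ and every $(\mathbf H_{d,1},\dots,\mathbf H_{d,K})$: (a) $P_{\mathrm{band}}=P_{\mathrm{fully}}$, simultaneously for all $d_1,\dots,d_K$, all $\mathcal W$ and all utilities $F$ such that $\mathbf H\mapsto\sup_{\mathbf W\in\mathcal W}F(\mathbf W,\mathbf H)$ is lower semicontinuous (for example, all $F$ for which $F(\mathbf W,\cdot)$ is continuous for every $\mathbf W\in\mathcal W$); (b) for Lebesgue-almost every real symmetric $\mathbf B$ there is a symmetric $\mathbf B'\in\mathcal B_q$ with $\mathbf H_{\mathrm{eff}}(\boldsymbol\Theta(\mathbf B'))=\mathbf H_{\mathrm{eff}}(\boldsymbol\Theta(\mathbf B))$, so that the band-connected RIS attains the same value $F(\mathbf W,\cdot)$ for every $\mathbf W$ and every utility $F$ whatsoever. -/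

import Mathlib

open MeasureTheory
open scoped Matrix

noncomputable section

namespace BDRIS

/-- The scattering matrix `Θ = (I + i Z₀ B)⁻¹ (I - i Z₀ B)` of a lossless reciprocal network with
susceptance matrix `B` and reference impedance `Z₀`. -/
def scatteringMatrix {NI : ℕ} (Z₀ : ℝ) (B : Matrix (Fin NI) (Fin NI) ℝ) :
    Matrix (Fin NI) (Fin NI) ℂ :=
  (1 + (Complex.I * (Z₀ : ℂ)) • B.map Complex.ofReal)⁻¹ *
    (1 - (Complex.I * (Z₀ : ℂ)) • B.map Complex.ofReal)

/-- The effective channel `H_{d,k} + H_{r,k} Θ G` of user `k`. -/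
def userChannel {K NT NI : ℕ} {Nr : Fin K → ℕ}
    (Hd : ∀ k : Fin K, Matrix (Fin (Nr k)) (Fin NT) ℂ)
    (Hr : ∀ k : Fin K, Matrix (Fin (Nr k)) (Fin NI) ℂ)
    (G : Matrix (Fin NI) (Fin NT) ℂ) (Θ : Matrix (Fin NI) (Fin NI) ℂ) (k : Fin K) :
    Matrix (Fin (Nr k)) (Fin NT) ℂ :=
  Hd k + Hr k * Θ * G

/-- The effective channel of all users: the matrices of the users stacked on top of each other,
with rows indexed by the pairs (user, receive antenna of that user). -/
def effectiveChannel {K NT NI : ℕ} {Nr : Fin K → ℕ}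
    (Hd : ∀ k : Fin K, Matrix (Fin (Nr k)) (Fin NT) ℂ)
    (Hr : ∀ k : Fin K, Matrix (Fin (Nr k)) (Fin NI) ℂ)
    (G : Matrix (Fin NI) (Fin NT) ℂ) (Θ : Matrix (Fin NI) (Fin NI) ℂ) :
    Matrix (Σ k : Fin K, Fin (Nr k)) (Fin NT) ℂ :=
  Matrix.of fun p j => userChannel Hd Hr G Θ p.1 p.2 j

/-- The optimal value of the joint beamforming and RIS design problem: the supremum of
`F(W, H_eff(Θ))` over `W ∈ 𝒲` and over the scattering matrices `Θ` of the symmetric susceptance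
matrices `B ∈ 𝓑`.  The columns of `W = [W₁, …, W_K]` are indexed by the pairs
(user, data stream of that user). -/
def optimalValue {K NT NI : ℕ} {Nr d : Fin K → ℕ} (Z₀ : ℝ)
    (Hd : ∀ k : Fin K, Matrix (Fin (Nr k)) (Fin NT) ℂ)
    (Hr : ∀ k : Fin K, Matrix (Fin (Nr k)) (Fin NI) ℂ)
    (G : Matrix (Fin NI) (Fin NT) ℂ)
    (F : Matrix (Fin NT) (Σ k : Fin K, Fin (d k)) ℂ →
      Matrix (Σ k : Fin K, Fin (Nr k)) (Fin NT) ℂ → EReal)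
    (𝒲 : Set (Matrix (Fin NT) (Σ k : Fin K, Fin (d k)) ℂ))
    (𝓑 : Set (Matrix (Fin NI) (Fin NI) ℝ)) : EReal :=
  sSup {v | ∃ (W : Matrix (Fin NT) (Σ k : Fin K, Fin (d k)) ℂ)
      (Θ : Matrix (Fin NI) (Fin NI) ℂ) (B : Matrix (Fin NI) (Fin NI) ℝ),
    Θ = scatteringMatrix Z₀ B ∧ Bᵀ = B ∧ B ∈ 𝓑 ∧ W ∈ 𝒲 ∧
      v = F W (effectiveChannel Hd Hr G Θ)}

/-- The set `𝓑_𝒢` of matrices whose off-diagonal entries vanish outside the edges of `𝒢`. -/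
def susceptanceSet {NI : ℕ} (𝒢 : SimpleGraph (Fin NI)) : Set (Matrix (Fin NI) (Fin NI) ℝ) :=
  {B | ∀ n m, n ≠ m → ¬ 𝒢.Adj n m → B n m = 0}

/-- The band matrices of band width `q`: `B n m = 0` whenever `|m - n| > q`. -/
def bandMatrices (NI q : ℕ) : Set (Matrix (Fin NI) (Fin NI) ℝ) :=
  {B | ∀ n m : Fin NI, (q : ℤ) < |(m : ℤ) - (n : ℤ)| → B n m = 0}

/-- The `q`-step path graph: distinct vertices are adjacent iff their indices differ by at
most `q`. -/
def stepPathGraph (NI q : ℕ) : SimpleGraph (Fin NI) where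
  Adj n m := n ≠ m ∧ |(m : ℤ) - (n : ℤ)| ≤ (q : ℤ)
  symm := ⟨fun n m h => ⟨h.1.symm, by rw [abs_sub_comm]; exact h.2⟩⟩
  loopless := ⟨fun _ h => h.1 rfl⟩

instance (NI q : ℕ) : DecidableRel (stepPathGraph NI q).Adj := fun n m =>
  inferInstanceAs (Decidable (n ≠ m ∧ |(m : ℤ) - (n : ℤ)| ≤ (q : ℤ)))

/-- `D = min {∑ₖ Nₖ, N_T}`. -/
def channelDoF {K : ℕ} (Nr : Fin K → ℕ) (NT : ℕ) : ℕ := min (∑ k, Nr k) NT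

/-- `L = min {D, N_I / 2}`, a rational number (a half-integer if `N_I` is odd and `2 D ≥ N_I`). -/
def archParam {K : ℕ} (Nr : Fin K → ℕ) (NT NI : ℕ) : ℚ :=
  min (channelDoF Nr NT : ℚ) ((NI : ℚ) / 2)

/-- `∑_{m > n} A n m = min {2 L - 1, N_I - n}` for `1 ≤ n ≤ N_I - 1`.  Rows are numbered from `0`
in the code, so that the row `n : Fin NI` is row number `n + 1` of the matrix. -/
def RowSumCondition {NI : ℕ} (L : ℚ) (A : Matrix (Fin NI) (Fin NI) ℚ) : Prop :=
  ∀ n : Fin NI, (n : ℕ) + 1 ≤ NI - 1 →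
    ∑ m ∈ Finset.Ioi n, A n m = min (2 * L - 1) ((NI : ℚ) - ((n : ℚ) + 1))

/-- `A = P Ā Pᵀ` for a matrix `Ā` that satisfies the row sum condition, where `P` is the
permutation matrix of `σ`. -/
def AdjacencyCondition {NI : ℕ} (L : ℚ) (A : Matrix (Fin NI) (Fin NI) ℚ)
    (σ : Equiv.Perm (Fin NI)) : Prop :=
  ∃ A' : Matrix (Fin NI) (Fin NI) ℚ,
    A = σ.permMatrix ℚ * A' * (σ.permMatrix ℚ)ᵀ ∧ RowSumCondition L A'

/-- The symmetric matrix with entry `x s(n, m)` at `(n, m)`: the coordinates `x` parametrize the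
symmetric real matrices linearly and bijectively by their entries on and above the diagonal. -/
def symmetricOfEntries {NI : ℕ} (x : Sym2 (Fin NI) → ℝ) : Matrix (Fin NI) (Fin NI) ℝ :=
  Matrix.of fun n m => x s(n, m)

end BDRIS

end

/-! Put `A = I + i Z₀ B`. Then `Θ = 2 A⁻¹ - I`, so the effective channel depends on `B` only through
`H A⁻¹ G`, with `H` the stacked `H_r`. With `X = H A⁻¹`, a symmetric real `B'` with `X (B' - B) = 0`
satisfies `X A' = X A = H`, hence `H A'⁻¹ = X` and the channel is unchanged. If `N_T` is the smaller
dimension, the same argument runs with `Gᵀ` in place of `H`, since `A` is symmetric.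

The equation `X v = 0` with real `v` is `r = 2D` real equations, so any `r + 1` consecutive indices
carry a nonzero real solution; generically both its end entries are nonzero
(`exists_kernel_vector`). Symmetrized products of two such vectors clear the diagonals of `B` from
the outside in, until only distances below `r` remain (`exists_band_sub_mem`): band width `2D - 1`.
If `N_I ≤ 2D`, the band is the whole matrix.

Genericity is the nonvanishing of real-analytic determinants, so one good point suffices
(`ae_ne_zero_of_analyticOnNhd`): an explicit matrix for the channels, then `B = 0` for the
susceptances. Equality of the optimal values follows because a set of full measure is dense and
strict superlevel sets of a lower semicontinuous function are open (`optimalValue_eq_of_ae`). -/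

namespace BDRIS

/-! ### Zero sets of analytic functions -/

/-- The zero set of a nonzero real analytic function is a null set. -/
theorem ae_ne_zero_of_analyticOnNhd {E : Type*} [NormedAddCommGroup E] [NormedSpace ℝ E]
    [FiniteDimensional ℝ E] [MeasurableSpace E] [BorelSpace E] (μ : Measure E)
    [μ.IsAddHaarMeasure] {f : E → ℝ} (hf : AnalyticOnNhd ℝ f Set.univ) {p : E} (hp : f p ≠ 0) :
    ∀ᵐ x ∂μ, f x ≠ 0 := by
  have hfc : Continuous f := continuousOn_univ.1 hf.continuousOn
  -- On each line through `p` the function is nonzero at `t = 0`, so its zeros there are discrete.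
  -- Fubini then gives one `t ≠ 0` that works for almost every `y`, and the affine map `y ↦ (p - t
  -- p) + t y` only rescales `μ`.
  have hline : ∀ y : E, ∀ᵐ t : ℝ, f ((p - t • p) + t • y) ≠ 0 := by
    intro y
    have hg : AnalyticOnNhd ℝ (fun t : ℝ => f ((p - t • p) + t • y)) Set.univ := by
      intro t _
      refine AnalyticAt.fun_comp (hf _ (Set.mem_univ _)) ?_
      fun_prop
    have h0 : (fun t : ℝ => f ((p - t • p) + t • y)) 0 ≠ 0 := by simpa using hp
    have h1 := hg.preimage_zero_mem_codiscrete h0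
    have h2 := ae_restrict_le_codiscreteWithin (μ := (volume : Measure ℝ)) MeasurableSet.univ h1
    rw [Measure.restrict_univ] at h2
    filter_upwards [h2] with t ht
    simpa using ht
  have hmeas : MeasurableSet {z : E × ℝ | f ((p - z.2 • p) + z.2 • z.1) ≠ 0} := by
    have hc : Continuous fun z : E × ℝ => f ((p - z.2 • p) + z.2 • z.1) := by fun_prop
    exact (isOpen_ne_fun hc continuous_const).measurableSet
  have hswap : ∀ᵐ t : ℝ, ∀ᵐ y ∂μ, f ((p - t • p) + t • y) ≠ 0 :=
    (Measure.ae_ae_comm (μ := μ) (ν := (volume : Measure ℝ))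
      (p := fun y t => f ((p - t • p) + t • y) ≠ 0) hmeas).1 (Filter.Eventually.of_forall hline)
  have hne : ∀ᵐ t : ℝ, t ≠ 0 := by simp [ae_iff]
  obtain ⟨t, ht, ht0⟩ := (hswap.and hne).exists
  have hpre : μ ((fun y => t • y) ⁻¹' ((fun y => (p - t • p) + y) ⁻¹' {x | ¬ f x ≠ 0})) = 0 := ht
  rw [Measure.addHaar_preimage_smul μ ht0, measure_preimage_add] at hpre
  rw [ae_iff]
  rcases mul_eq_zero.1 hpre with h | h
  · exfalso
    rw [ENNReal.ofReal_eq_zero] at h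
    exact absurd h (not_le.2 (abs_pos.2 (inv_ne_zero (pow_ne_zero _ ht0))))
  · exact h

theorem analyticAt_det {E 𝕜 : Type*} [NormedAddCommGroup E] [NormedSpace ℝ E] [NormedField 𝕜]
    [NormedAlgebra ℝ 𝕜] {n : Type*} [Fintype n] [DecidableEq n] {M : E → Matrix n n 𝕜} {x : E}
    (hM : ∀ i j, AnalyticAt ℝ (fun y => M y i j) x) : AnalyticAt ℝ (fun y => (M y).det) x := by
  simp only [Matrix.det_apply']
  refine Finset.analyticAt_fun_sum _ fun σ _ => ?_
  refine analyticAt_const.mul (Finset.analyticAt_fun_prod _ fun i _ => hM _ _)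

theorem analyticAt_adjugate {E 𝕜 : Type*} [NormedAddCommGroup E] [NormedSpace ℝ E] [NormedField 𝕜]
    [NormedAlgebra ℝ 𝕜] {n : Type*} [Fintype n] [DecidableEq n] {M : E → Matrix n n 𝕜} {x : E}
    (hM : ∀ i j, AnalyticAt ℝ (fun y => M y i j) x) (i j : n) :
    AnalyticAt ℝ (fun y => (M y).adjugate i j) x := by
  simp only [Matrix.adjugate_apply]
  refine analyticAt_det fun a b => ?_
  simp only [Matrix.updateRow_apply]
  split_ifs
  · exact analyticAt_const
  · exact hM a b

/-! ### Real kernels on windows of consecutive indices -/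

/-- The action of a complex matrix on real vectors. -/
noncomputable def realMulVec {ρ n : Type*} [Fintype n] (X : Matrix ρ n ℂ) : (n → ℝ) →ₗ[ℝ] (ρ → ℂ) :=
  (X.mulVecLin.restrictScalars ℝ) ∘ₗ (Complex.ofRealAm.toLinearMap.compLeft n)

theorem realMulVec_apply {ρ n : Type*} [Fintype n] (X : Matrix ρ n ℂ) (v : n → ℝ) (a : ρ) :
    realMulVec X v a = ∑ j, X a j * (v j : ℂ) := rfl

/-- The embedding of `s` consecutive indices, starting at `i`. -/
def windowEmb {N i s : ℕ} (h : i + s ≤ N) (j : Fin s) : Fin N := ⟨i + j, by omega⟩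

theorem windowEmb_injective {N i s : ℕ} (h : i + s ≤ N) : Function.Injective (windowEmb h) := by
  intro a b hab
  simp only [windowEmb, Fin.mk.injEq] at hab
  omega

theorem extend_windowEmb_support {N i s : ℕ} (h : i + s ≤ N) (w : Fin s → ℝ) (j : Fin N)
    (hj : Function.extend (windowEmb h) w 0 j ≠ 0) : i ≤ j ∧ (j : ℕ) < i + s := by
  by_contra hc
  refine hj (Function.extend_apply' _ _ _ ?_)
  rintro ⟨a, rfl⟩
  simp only [windowEmb] at hc
  omega

theorem realMulVec_extend {ρ : Type*} {N i s : ℕ} (X : Matrix ρ (Fin N) ℂ) (h : i + s ≤ N)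
    (w : Fin s → ℝ) : realMulVec X (Function.extend (windowEmb h) w 0) =
      realMulVec (X.submatrix id (windowEmb h)) w := by
  ext a
  simp only [realMulVec_apply]
  refine (Fintype.sum_of_injective (windowEmb h) (windowEmb_injective h) _ _ ?_ ?_).symm
  · intro j hj
    rw [Function.extend_apply' _ _ _ (by simpa using hj)]
    simp
  · intro j
    rw [(windowEmb_injective h).extend_apply]
    rfl

/-- No nonzero real vector supported on the indices `i, …, i + s - 1` is in the kernel of `X`. -/
def WindowInjective {ρ : Type*} {N : ℕ} (X : Matrix ρ (Fin N) ℂ) (i s : ℕ) : Prop :=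
  ∀ v : Fin N → ℝ, (∀ j, v j ≠ 0 → i ≤ j ∧ (j : ℕ) < i + s) → realMulVec X v = 0 → v = 0

theorem windowInjective_iff {ρ : Type*} {N i s : ℕ} (X : Matrix ρ (Fin N) ℂ) (h : i + s ≤ N) :
    WindowInjective X i s ↔ ∀ w, realMulVec (X.submatrix id (windowEmb h)) w = 0 → w = 0 := by
  constructor
  · intro hX w hw
    have := hX _ (extend_windowEmb_support h w) (by rw [realMulVec_extend, hw])
    ext j
    have h2 := congrFun this (windowEmb h j)
    rwa [(windowEmb_injective h).extend_apply] at h2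
  · intro hX v hv hXv
    have hext : v = Function.extend (windowEmb h) (v ∘ windowEmb h) 0 := by
      ext j
      by_cases hj : ∃ a, windowEmb h a = j
      · obtain ⟨a, rfl⟩ := hj
        rw [(windowEmb_injective h).extend_apply]; rfl
      · rw [Function.extend_apply' _ _ _ hj]
        by_contra hne
        have := hv j hne
        exact hj ⟨⟨j - i, by omega⟩, by ext; simp only [windowEmb]; omega⟩
    rw [hext, realMulVec_extend] at hXv
    rw [hext, hX _ hXv]
    ext j
    by_cases hj : ∃ a, windowEmb h a = j
    · obtain ⟨a, rfl⟩ := hj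
      rw [(windowEmb_injective h).extend_apply]; rfl
    · rw [Function.extend_apply' _ _ _ hj]

/-- The real square matrix of the real and imaginary parts of `s` consecutive columns. -/
def windowMatrix {ρ : Type*} {N i s : ℕ} (e : ρ ⊕ ρ ≃ Fin s) (h : i + s ≤ N)
    (X : Matrix ρ (Fin N) ℂ) : Matrix (Fin s) (Fin s) ℝ :=
  Matrix.of fun k j => Sum.elim (fun a => (X a (windowEmb h j)).re)
    (fun a => (X a (windowEmb h j)).im) (e.symm k)

/-- A complex equation is two real ones, so with `s = 2 |ρ|` the real system on the window is
square. -/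
theorem windowInjective_iff_det {ρ : Type*} {N i s : ℕ} (e : ρ ⊕ ρ ≃ Fin s) (h : i + s ≤ N)
    (X : Matrix ρ (Fin N) ℂ) : WindowInjective X i s ↔ (windowMatrix e h X).det ≠ 0 := by
  rw [windowInjective_iff X h, ← not_iff_not, not_not, ← Matrix.exists_mulVec_eq_zero_iff]
  push Not
  refine exists_congr fun w => ?_
  rw [and_comm]
  refine and_congr_right fun _ => ?_
  rw [funext_iff, funext_iff, ← e.forall_congr_right, Sum.forall, ← forall_and]
  refine forall_congr' fun a => ?_
  rw [Complex.ext_iff, realMulVec_apply, Complex.re_sum, Complex.im_sum]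
  simp [windowMatrix, Matrix.mulVec, dotProduct]

theorem exists_windowInjective {ρ : Type*} [DecidableEq ρ] {N i s : ℕ} (e : ρ ⊕ ρ ≃ Fin s)
    (h : i + s ≤ N) : ∃ X : Matrix ρ (Fin N) ℂ, WindowInjective X i s := by
  -- The window columns are the unit vectors and `i` times the unit vectors, so the real window
  -- matrix is the identity.
  refine ⟨Matrix.of fun a => Function.extend (windowEmb h) (fun j => Sum.elim
    (fun b => if a = b then 1 else 0) (fun b => if a = b then Complex.I else 0) (e.symm j)) 0, ?_⟩
  rw [windowInjective_iff_det e h]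
  suffices h1 : windowMatrix e h _ = 1 by rw [h1, Matrix.det_one]; exact one_ne_zero
  ext k j
  obtain ⟨k, rfl⟩ := e.surjective k
  obtain ⟨j, rfl⟩ := e.surjective j
  simp only [windowMatrix, Matrix.of_apply, (windowEmb_injective h).extend_apply,
    Equiv.symm_apply_apply, Matrix.one_apply, e.injective.eq_iff]
  rcases k with k | k <;> rcases j with j | j <;> simp <;> split_ifs <;> simp

theorem ae_windowInjective {ρ E : Type*} {N i s : ℕ} (e : ρ ⊕ ρ ≃ Fin s)
    (h : i + s ≤ N) [NormedAddCommGroup E] [NormedSpace ℝ E]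
    [FiniteDimensional ℝ E] [MeasurableSpace E] [BorelSpace E] (μ : Measure E)
    [μ.IsAddHaarMeasure] {X : E → Matrix ρ (Fin N) ℂ}
    (hX : ∀ a j x, AnalyticAt ℝ (fun y => X y a j) x) {p : E} (hp : WindowInjective (X p) i s) :
    ∀ᵐ x ∂μ, WindowInjective (X x) i s := by
  simp only [windowInjective_iff_det e h] at hp ⊢
  refine ae_ne_zero_of_analyticOnNhd (f := fun x => (windowMatrix e h (X x)).det) μ ?_ hp
  intro x _
  refine analyticAt_det fun k j => ?_
  simp only [windowMatrix, Matrix.of_apply]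
  rcases e.symm k with a | a
  · exact (Complex.reCLM.analyticAt _).fun_comp (hX a _ x)
  · exact (Complex.imCLM.analyticAt _).fun_comp (hX a _ x)


/-! ### Kernel vectors and elimination to band form -/

/-- There are `r + 1` real unknowns for `r` real equations. If an end entry vanished, the solution
would live on `r` consecutive indices and be zero. -/
theorem exists_kernel_vector {ρ : Type*} [Fintype ρ] {N r : ℕ} (hr : r = 2 * Fintype.card ρ)
    (X : Matrix ρ (Fin N) ℂ) (hX : ∀ i, i + r ≤ N → WindowInjective X i r) (i : ℕ)
    (hi : i + r < N) : ∃ v : Fin N → ℝ, realMulVec X v = 0 ∧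
      (∀ j, v j ≠ 0 → i ≤ j ∧ (j : ℕ) ≤ i + r) ∧ v ⟨i, by omega⟩ ≠ 0 ∧ v ⟨i + r, hi⟩ ≠ 0 := by
  have hi' : i + (r + 1) ≤ N := by omega
  have hdim : Module.finrank ℝ (ρ → ℂ) < Module.finrank ℝ (Fin (r + 1) → ℝ) := by
    rw [Module.finrank_pi_fintype]
    simp [Complex.finrank_real_complex, hr]
    omega
  obtain ⟨w, hw, hw0⟩ := Submodule.exists_mem_ne_zero_of_ne_bot
    (LinearMap.ker_ne_bot_of_finrank_lt
      (f := realMulVec (X.submatrix id (windowEmb hi'))) hdim)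
  have hsupp := extend_windowEmb_support hi' w
  have hker : realMulVec X (Function.extend (windowEmb hi') w 0) = 0 := by
    rw [realMulVec_extend]; exact hw
  have hne : Function.extend (windowEmb hi') w 0 ≠ 0 := by
    intro h
    refine hw0 (funext fun j => ?_)
    have h2 := congrFun h (windowEmb hi' j)
    rwa [(windowEmb_injective hi').extend_apply] at h2
  refine ⟨_, hker, fun j hj => ⟨(hsupp j hj).1, by have := hsupp j hj; omega⟩, ?_, ?_⟩
  · intro h0
    refine hne (hX (i + 1) (by omega) _ (fun j hj => ?_) hker)
    have h1 := hsupp j hj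
    have h2 : (j : ℕ) ≠ i := by
      rintro rfl
      exact hj h0
    omega
  · intro h0
    refine hne (hX i (by omega) _ (fun j hj => ?_) hker)
    have h1 := hsupp j hj
    have h2 : (j : ℕ) ≠ i + r := by
      intro h
      have : j = ⟨i + r, hi⟩ := Fin.ext h
      exact hj (this ▸ h0)
    omega

/-- A symmetric matrix can be changed into a band matrix by a symmetric matrix whose columns are
in `V`, if `V` has enough vectors supported on `r + 1` consecutive indices. -/
theorem exists_band_sub_mem {N r : ℕ} (V : Submodule ℝ (Fin N → ℝ))
    (hV : ∀ i, ∀ hi : i + r < N, ∃ v ∈ V, (∀ j, v j ≠ 0 → i ≤ j ∧ (j : ℕ) ≤ i + r) ∧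
      v ⟨i, by omega⟩ ≠ 0 ∧ v ⟨i + r, hi⟩ ≠ 0) (m : ℕ) (B : Matrix (Fin N) (Fin N) ℝ)
    (hB : Bᵀ = B) (hBm : ∀ a b : Fin N, (a : ℕ) + (r + m) ≤ b → B a b = 0) :
    ∃ B' : Matrix (Fin N) (Fin N) ℝ, B'ᵀ = B' ∧ (∀ a b : Fin N, (a : ℕ) + r ≤ b → B' a b = 0) ∧
      ∀ b, (fun a => B' a b - B a b) ∈ V := by
  -- Zero vectors fill the positions without a full window, so that `K` is defined on all of `ℕ`.
  have hK : ∀ i, ∃ v ∈ V, ∀ hi : i + r < N, (∀ j, v j ≠ 0 → i ≤ j ∧ (j : ℕ) ≤ i + r) ∧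
      v ⟨i, by omega⟩ ≠ 0 ∧ v ⟨i + r, hi⟩ ≠ 0 := by
    intro i
    by_cases hi : i + r < N
    · obtain ⟨v, hv, h⟩ := hV i hi
      exact ⟨v, hv, fun _ => h⟩
    · exact ⟨0, V.zero_mem, fun h => absurd h hi⟩
  choose K hKV hK using hK
  induction m generalizing B with
  | zero => exact ⟨B, hB, hBm, fun b => by
    simp only [sub_self]; exact V.zero_mem⟩
  | succ m ih =>
    -- The supports start at `i` and `i + m` and have length `r + 1`, so among the entries with `b -
    -- a ≥ r + m` only `(i, i + r + m)` can be nonzero. Each `P i` therefore adjusts one entry of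
    -- the outermost remaining diagonal.
    let P : ℕ → Matrix (Fin N) (Fin N) ℝ := fun i => Matrix.of fun a b =>
      K i a * K (i + m) b + K (i + m) a * K i b
    let t : Fin N → ℝ := fun i =>
      if h : i + (r + m) < N then B i ⟨i + (r + m), h⟩ / P i i ⟨i + (r + m), h⟩ else 0
    let Δ : Matrix (Fin N) (Fin N) ℝ := Matrix.of fun a b => ∑ i, t i * P i a b
    have hPsymm : ∀ i a b, P i a b = P i b a := by
      intro i a b; simp only [P, Matrix.of_apply]; ring
    have hP0 : ∀ (i : ℕ) (a b : Fin N), i + (r + m) < N → (a : ℕ) + (r + m) ≤ b →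
        P i a b ≠ 0 → i = a ∧ (b : ℕ) = a + (r + m) := by
      intro i a b hi hab hne
      have h1 := (hK i (by omega)).1
      have h2 := (hK (i + m) (by omega)).1
      by_cases hx : K i a * K (i + m) b = 0
      · have hy : K (i + m) a * K i b ≠ 0 := by
          intro hy; exact hne (by simp only [P, Matrix.of_apply, hx, hy, add_zero])
        have := h1 b (right_ne_zero_of_mul hy)
        have := h2 a (left_ne_zero_of_mul hy)
        omega
      · have := h1 a (left_ne_zero_of_mul hx)
        have := h2 b (right_ne_zero_of_mul hx)
        omega
    have hPne : ∀ (i : Fin N) (hi : i + (r + m) < N), P i i ⟨i + (r + m), hi⟩ ≠ 0 := by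
      intro i hi
      have h1 := hK i (by omega)
      have h2 := hK (i + m) (by omega)
      have h3 : K (i + m) ⟨i + (r + m), hi⟩ ≠ 0 := by
        have := h2.2.2
        rwa [show (⟨i + m + r, by omega⟩ : Fin N) = ⟨i + (r + m), hi⟩ from
          Fin.ext (by simp only; omega)] at this
      have h4 : K i i * K (i + m) ⟨i + (r + m), hi⟩ ≠ 0 := mul_ne_zero h1.2.1 h3
      -- For `m = 0` the two products coincide and double; for `m > 0` the second vanishes, because
      -- `K (i + m)` is zero at `i`.
      rcases Nat.eq_zero_or_pos m with rfl | hm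
      · have : P i i ⟨i + (r + 0), hi⟩ = 2 * (K i i * K (i + 0) ⟨i + (r + 0), hi⟩) := by
          simp only [P, Matrix.of_apply, add_zero]; ring
        rw [this]; exact mul_ne_zero two_ne_zero h4
      · have h5 : K (i + m) i = 0 := by
          by_contra h
          have := h2.1 _ h
          omega
        simpa only [P, Matrix.of_apply, h5, zero_mul, add_zero] using h4
    have hΔsymm : Δᵀ = Δ := by
      ext a b
      simp only [Δ, Matrix.transpose_apply, Matrix.of_apply]
      exact Finset.sum_congr rfl fun i _ => by rw [hPsymm]
    have hΔ : ∀ a b : Fin N, (a : ℕ) + (r + m) ≤ b → Δ a b = B a b := by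
      intro a b hab
      have hzero : ∀ i : Fin N, ¬ (i = a ∧ (b : ℕ) = a + (r + m)) → t i * P i a b = 0 := by
        intro i hi
        by_cases h : i + (r + m) < N
        · rw [mul_eq_zero]; right
          by_contra hne
          have := hP0 i a b h hab hne
          exact hi ⟨Fin.ext this.1, this.2⟩
        · simp [t, h]
      simp only [Δ, Matrix.of_apply]
      by_cases hb : (b : ℕ) = a + (r + m)
      · rw [Finset.sum_eq_single a (fun i _ hi => hzero i (fun h => hi h.1)) (by simp)]
        have hlt : a + (r + m) < N := by omega
        obtain rfl : b = ⟨a + (r + m), hlt⟩ := Fin.ext hb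
        simp only [t, dif_pos hlt]
        exact div_mul_cancel₀ _ (hPne a hlt)
      · rw [hBm a b (by omega)]
        exact Finset.sum_eq_zero fun i _ => hzero i fun h => hb h.2
    have hΔV : ∀ b, (fun a => Δ a b) ∈ V := by
      intro b
      have : (fun a => Δ a b) = ∑ i : Fin N, t i • (K (i + m) b • K i + K i b • K (i + m)) := by
        ext a
        simp only [Δ, P, Matrix.of_apply, Finset.sum_apply, Pi.smul_apply, Pi.add_apply,
          smul_eq_mul]
        exact Finset.sum_congr rfl fun i _ => by ring
      rw [this]
      exact V.sum_mem fun i _ => V.smul_mem _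
        (V.add_mem (V.smul_mem _ (hKV _)) (V.smul_mem _ (hKV _)))
    obtain ⟨B', h1, h2, h3⟩ := ih (B - Δ) (by rw [Matrix.transpose_sub, hB, hΔsymm])
      (fun a b hab => by rw [Matrix.sub_apply, hΔ a b hab, sub_self])
    refine ⟨B', h1, h2, fun b => ?_⟩
    have h4 := V.sub_mem (h3 b) (hΔV b)
    convert h4 using 1
    ext a
    simp only [Pi.sub_apply, Matrix.sub_apply]
    ring

/-! ### Susceptance matrices and the scattering matrix -/

/-- `I + i Z₀ B`. -/
noncomputable def admittanceFactor {N : ℕ} (Z₀ : ℝ) (B : Matrix (Fin N) (Fin N) ℝ) : Matrix (Fin N) (Fin N) ℂ :=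
  1 + (Complex.I * (Z₀ : ℂ)) • B.map Complex.ofReal

/-- Since `v* B v` is real, the real part of `v* A v` is `‖v‖²`, which excludes a kernel. -/
theorem det_admittanceFactor_ne_zero {N : ℕ} (Z₀ : ℝ) {B : Matrix (Fin N) (Fin N) ℝ}
    (hB : Bᵀ = B) : (admittanceFactor Z₀ B).det ≠ 0 := by
  intro h
  obtain ⟨v, hv, hv0⟩ := Matrix.exists_mulVec_eq_zero_iff.2 h
  have hH : (B.map Complex.ofReal).IsHermitian := by
    ext a b
    have := congrFun (congrFun hB a) b
    simp only [Matrix.transpose_apply] at this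
    simp [Matrix.conjTranspose_apply, this]
  have him : (star v ⬝ᵥ (B.map Complex.ofReal) *ᵥ v).im = 0 := hH.im_star_dotProduct_mulVec_self v
  have h1 : star v ⬝ᵥ (admittanceFactor Z₀ B) *ᵥ v = 0 := by rw [hv0, dotProduct_zero]
  rw [admittanceFactor, Matrix.add_mulVec, Matrix.one_mulVec, Matrix.smul_mulVec, dotProduct_add,
    dotProduct_smul] at h1
  have h2 : (star v ⬝ᵥ v).re = 0 := by
    have := congrArg Complex.re h1
    simpa [him] using this
  refine hv (funext fun a => ?_)
  have h3 : ∑ a, Complex.normSq (v a) = 0 := by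
    rw [← h2, dotProduct, Complex.re_sum]
    exact Finset.sum_congr rfl fun a _ => by simp [Complex.normSq_apply]
  exact Complex.normSq_eq_zero.1
    ((Finset.sum_eq_zero_iff_of_nonneg fun a _ => Complex.normSq_nonneg _).1 h3 a
      (Finset.mem_univ a))

theorem scatteringMatrix_eq {N : ℕ} (Z₀ : ℝ) {B : Matrix (Fin N) (Fin N) ℝ} (hB : Bᵀ = B) :
    scatteringMatrix Z₀ B = (2 : ℂ) • (admittanceFactor Z₀ B)⁻¹ - 1 := by
  have hdet : IsUnit (admittanceFactor Z₀ B).det :=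
    isUnit_iff_ne_zero.2 (det_admittanceFactor_ne_zero Z₀ hB)
  have h : 1 - (Complex.I * (Z₀ : ℂ)) • B.map Complex.ofReal =
      (2 : ℂ) • (1 : Matrix (Fin N) (Fin N) ℂ) - admittanceFactor Z₀ B := by
    rw [admittanceFactor, two_smul]; abel
  rw [scatteringMatrix, h]
  change (admittanceFactor Z₀ B)⁻¹ * _ = _
  rw [mul_sub, Matrix.nonsing_inv_mul _ hdet, mul_smul_comm, mul_one]

theorem inv_admittanceFactor_transpose {N : ℕ} (Z₀ : ℝ) {B : Matrix (Fin N) (Fin N) ℝ}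
    (hB : Bᵀ = B) : (admittanceFactor Z₀ B)⁻¹ᵀ = (admittanceFactor Z₀ B)⁻¹ := by
  rw [Matrix.transpose_nonsing_inv]
  congr 1
  simp [admittanceFactor, ← Matrix.transpose_map, hB]

/-- The inverse may be replaced by the adjugate: a scalar factor does not change real kernels. -/
theorem windowInjective_mul_inv_iff {ρ : Type*} {N i s : ℕ} (H : Matrix ρ (Fin N) ℂ)
    {A : Matrix (Fin N) (Fin N) ℂ} (hA : A.det ≠ 0) :
    WindowInjective (H * A⁻¹) i s ↔ WindowInjective (H * A.adjugate) i s := by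
  have h : H * A⁻¹ = A.det⁻¹ • (H * A.adjugate) := by
    rw [Matrix.inv_def, Ring.inverse_eq_inv', Matrix.mul_smul]
  have h2 : ∀ v, realMulVec (H * A⁻¹) v = A.det⁻¹ • realMulVec (H * A.adjugate) v := by
    intro v
    ext a
    rw [h]
    simp only [realMulVec_apply, Matrix.smul_apply, Pi.smul_apply, smul_eq_mul, Finset.mul_sum,
      mul_assoc]
  simp only [WindowInjective, h2, smul_eq_zero, inv_eq_zero, hA, false_or]

theorem transpose_symmetricOfEntries {N : ℕ} (x : Sym2 (Fin N) → ℝ) :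
    (symmetricOfEntries x)ᵀ = symmetricOfEntries x := by
  ext a b
  simp only [symmetricOfEntries, Matrix.transpose_apply, Matrix.of_apply, Sym2.eq_swap]

/-- The adjugate is polynomial in the entries of `B`, and at `B = 0` the matrix is `H` itself. -/
theorem ae_windowInjective_mul_inv {ρ : Type*} {N i s : ℕ} (e : ρ ⊕ ρ ≃ Fin s)
    (h : i + s ≤ N) (Z₀ : ℝ) (H : Matrix ρ (Fin N) ℂ) (hH : WindowInjective H i s) :
    ∀ᵐ x : Sym2 (Fin N) → ℝ,
      WindowInjective (H * (admittanceFactor Z₀ (symmetricOfEntries x))⁻¹) i s := by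
  simp only [windowInjective_mul_inv_iff H
    (det_admittanceFactor_ne_zero Z₀ (transpose_symmetricOfEntries _))]
  refine ae_windowInjective e h volume (p := 0) (fun a j x => ?_) ?_
  · simp only [Matrix.mul_apply]
    refine Finset.analyticAt_fun_sum _ fun l _ => analyticAt_const.mul
      (analyticAt_adjugate (fun b c => ?_) l j)
    simp only [admittanceFactor, symmetricOfEntries, Matrix.add_apply, Matrix.smul_apply,
      Matrix.map_apply, Matrix.of_apply, smul_eq_mul]
    refine analyticAt_const.add (analyticAt_const.mul ?_)
    exact (Complex.ofRealCLM ∘L ContinuousLinearMap.proj (R := ℝ)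
      (φ := fun _ : Sym2 (Fin N) => ℝ) s(b, c)).analyticAt x
  · have : admittanceFactor Z₀ (symmetricOfEntries (0 : Sym2 (Fin N) → ℝ)) = 1 := by
      ext a b
      simp [admittanceFactor, symmetricOfEntries]
    rwa [this, Matrix.adjugate_one, Matrix.mul_one]

/-- A symmetric susceptance matrix can be replaced by a band matrix without changing
`H (I + i Z₀ B)⁻¹`. -/
theorem exists_band_mul_inv_eq {ρ : Type*} [Fintype ρ] {N r : ℕ} (hr : r = 2 * Fintype.card ρ)
    (Z₀ : ℝ) (H : Matrix ρ (Fin N) ℂ) {B : Matrix (Fin N) (Fin N) ℝ} (hB : Bᵀ = B)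
    (hX : ∀ i, i + r ≤ N → WindowInjective (H * (admittanceFactor Z₀ B)⁻¹) i r) :
    ∃ B' : Matrix (Fin N) (Fin N) ℝ, B'ᵀ = B' ∧ (∀ a b : Fin N, (a : ℕ) + r ≤ b → B' a b = 0) ∧
      H * (admittanceFactor Z₀ B')⁻¹ = H * (admittanceFactor Z₀ B)⁻¹ := by
  set X := H * (admittanceFactor Z₀ B)⁻¹ with hXdef
  -- With `m = N` the vanishing hypothesis on `B` is vacuous.
  obtain ⟨B', h1, h2, h3⟩ := exists_band_sub_mem (LinearMap.ker (realMulVec X))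
    (exists_kernel_vector hr X hX) N B hB (fun a b hab => by omega)
  refine ⟨B', h1, h2, ?_⟩
  have hdet : IsUnit (admittanceFactor Z₀ B).det :=
    isUnit_iff_ne_zero.2 (det_admittanceFactor_ne_zero Z₀ hB)
  have hdet' : IsUnit (admittanceFactor Z₀ B').det :=
    isUnit_iff_ne_zero.2 (det_admittanceFactor_ne_zero Z₀ h1)
  have h4 : X * (B'.map Complex.ofReal - B.map Complex.ofReal) = 0 := by
    ext a b
    have := congrFun (LinearMap.mem_ker.1 (h3 b)) a
    rw [realMulVec_apply] at this
    simpa [Matrix.mul_apply] using this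
  have h5 : admittanceFactor Z₀ B' = admittanceFactor Z₀ B +
      (Complex.I * (Z₀ : ℂ)) • (B'.map Complex.ofReal - B.map Complex.ofReal) := by
    rw [admittanceFactor, admittanceFactor, smul_sub]; abel
  have h6 : X * admittanceFactor Z₀ B' = H := by
    rw [h5, Matrix.mul_add, Matrix.mul_smul, h4, smul_zero, add_zero, hXdef, Matrix.mul_assoc,
      Matrix.nonsing_inv_mul _ hdet, Matrix.mul_one]
  rw [← h6, Matrix.mul_assoc, Matrix.mul_nonsing_inv _ hdet', Matrix.mul_one]


/-! ### Generic channels and generic susceptances -/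

theorem mem_bandMatrices {N q r : ℕ} (hr : r = q + 1) {B : Matrix (Fin N) (Fin N) ℝ} (hB : Bᵀ = B)
    (h : ∀ a b : Fin N, (a : ℕ) + r ≤ b → B a b = 0) : B ∈ bandMatrices N q := by
  intro n m hnm
  rcases lt_abs.1 hnm with h1 | h1
  · exact h n m (by omega)
  · rw [← hB]
    exact h m n (by omega)

theorem bandMatrices_eq_univ {N q : ℕ} (h : N ≤ q + 1) : bandMatrices N q = Set.univ := by
  refine Set.eq_univ_of_forall fun B n m hnm => ?_
  rcases lt_abs.1 hnm with h1 | h1 <;> omega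

theorem isAddHaarMeasure_volume_pi {ι : Type*} [Fintype ι] (α : ι → Type*)
    [∀ i, AddGroup (α i)] [∀ i, TopologicalSpace (α i)] [∀ i, MeasureSpace (α i)]
    [∀ i, SigmaFinite (volume : Measure (α i))]
    [∀ i, MeasurableAdd (α i)]
    (h : ∀ i, (volume : Measure (α i)).IsAddHaarMeasure) :
    (volume : Measure (∀ i, α i)).IsAddHaarMeasure :=
  have := h
  Measure.pi.isAddHaarMeasure fun i => (volume : Measure (α i))

/-- For a generic matrix `H`, almost every symmetric susceptance matrix can be replaced by a band
matrix without changing `H (I + i Z₀ B)⁻¹`. -/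
theorem ae_exists_band {ρ : Type*} [Fintype ρ] {N q : ℕ} (hq : q + 1 = 2 * Fintype.card ρ)
    (Z₀ : ℝ) (H : Matrix ρ (Fin N) ℂ)
    (hH : ∀ i, i + (q + 1) ≤ N → WindowInjective H i (q + 1)) :
    ∀ᵐ x : Sym2 (Fin N) → ℝ, ∃ B' : Matrix (Fin N) (Fin N) ℝ, B'ᵀ = B' ∧ B' ∈ bandMatrices N q ∧
      H * (admittanceFactor Z₀ B')⁻¹ = H * (admittanceFactor Z₀ (symmetricOfEntries x))⁻¹ := by
  have e : ρ ⊕ ρ ≃ Fin (q + 1) := Fintype.equivOfCardEq (by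
    rw [Fintype.card_sum, Fintype.card_fin]; omega)
  have h : ∀ i, ∀ᵐ x : Sym2 (Fin N) → ℝ, i + (q + 1) ≤ N →
      WindowInjective (H * (admittanceFactor Z₀ (symmetricOfEntries x))⁻¹) i (q + 1) := by
    intro i
    by_cases hi : i + (q + 1) ≤ N
    · filter_upwards [ae_windowInjective_mul_inv e hi Z₀ H (hH i hi)] with x hx _ using hx
    · exact Filter.Eventually.of_forall fun _ h => absurd h hi
  filter_upwards [ae_all_iff.2 h] with x hx
  obtain ⟨B', h1, h2, h3⟩ := exists_band_mul_inv_eq hq Z₀ H (transpose_symmetricOfEntries x) hx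
  exact ⟨B', h1, mem_bandMatrices rfl h1 h2, h3⟩

/-- Almost every element of a space that parametrizes all matrices linearly is generic. -/
theorem ae_forall_windowInjective {ρ E : Type*} [Fintype ρ] {N s : ℕ} (hs : s = 2 * Fintype.card ρ)
    [NormedAddCommGroup E] [NormedSpace ℝ E] [FiniteDimensional ℝ E] [MeasurableSpace E]
    [BorelSpace E] (μ : Measure E) [μ.IsAddHaarMeasure] {X : E → Matrix ρ (Fin N) ℂ}
    (hX : ∀ a j x, AnalyticAt ℝ (fun y => X y a j) x) (hsurj : Function.Surjective X) :
    ∀ᵐ x ∂μ, ∀ i, i + s ≤ N → WindowInjective (X x) i s := by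
  classical
  have e : ρ ⊕ ρ ≃ Fin s := Fintype.equivOfCardEq (by
    rw [Fintype.card_sum, Fintype.card_fin]; omega)
  refine ae_all_iff.2 fun i => ?_
  by_cases hi : i + s ≤ N
  · obtain ⟨Y, hY⟩ := exists_windowInjective e hi
    obtain ⟨p, rfl⟩ := hsurj Y
    filter_upwards [ae_windowInjective e hi μ hX hY] with x hx _ using hx
  · exact Filter.Eventually.of_forall fun _ h => absurd h hi

/-- The matrices of all users stacked on top of each other. -/
def stack {K n : ℕ} {Nr : Fin K → ℕ} (H : ∀ k : Fin K, Matrix (Fin (Nr k)) (Fin n) ℂ) :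
    Matrix (Σ k : Fin K, Fin (Nr k)) (Fin n) ℂ :=
  Matrix.of fun p j => H p.1 p.2 j

theorem effectiveChannel_eq {K NT NI : ℕ} {Nr : Fin K → ℕ}
    (Hd : ∀ k : Fin K, Matrix (Fin (Nr k)) (Fin NT) ℂ)
    (Hr : ∀ k : Fin K, Matrix (Fin (Nr k)) (Fin NI) ℂ)
    (G : Matrix (Fin NI) (Fin NT) ℂ) (Θ : Matrix (Fin NI) (Fin NI) ℂ) :
    effectiveChannel Hd Hr G Θ = stack Hd + stack Hr * Θ * G := by
  ext p j
  simp [effectiveChannel, userChannel, stack, Matrix.mul_apply]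

theorem effectiveChannel_congr {K NT NI : ℕ} {Nr : Fin K → ℕ}
    (Hd : ∀ k : Fin K, Matrix (Fin (Nr k)) (Fin NT) ℂ)
    (Hr : ∀ k : Fin K, Matrix (Fin (Nr k)) (Fin NI) ℂ)
    (G : Matrix (Fin NI) (Fin NT) ℂ) (Z₀ : ℝ) {B B' : Matrix (Fin NI) (Fin NI) ℝ} (hB : Bᵀ = B)
    (hB' : B'ᵀ = B') (h : stack Hr * (admittanceFactor Z₀ B')⁻¹ * G =
      stack Hr * (admittanceFactor Z₀ B)⁻¹ * G) :
    effectiveChannel Hd Hr G (scatteringMatrix Z₀ B') =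
      effectiveChannel Hd Hr G (scatteringMatrix Z₀ B) := by
  rw [effectiveChannel_eq, effectiveChannel_eq, scatteringMatrix_eq Z₀ hB,
    scatteringMatrix_eq Z₀ hB']
  simp only [Matrix.mul_sub, Matrix.sub_mul, Matrix.mul_smul, Matrix.smul_mul, h]

theorem ae_exists_band_effectiveChannel (K NT NI : ℕ) (Nr : Fin K → ℕ) (Z₀ : ℝ) (q : ℕ)
    (hq : q + 1 = min (2 * channelDoF Nr NT) NI) :
    ∀ᵐ c : (∀ k : Fin K, Fin (Nr k) → Fin NI → ℂ) × (Fin NI → Fin NT → ℂ) ∂volume,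
      ∀ Hd : ∀ k : Fin K, Matrix (Fin (Nr k)) (Fin NT) ℂ,
        ∀ᵐ x : Sym2 (Fin NI) → ℝ ∂volume,
          ∃ B : Matrix (Fin NI) (Fin NI) ℝ, Bᵀ = B ∧ B ∈ bandMatrices NI q ∧
            effectiveChannel Hd (fun k => Matrix.of (c.1 k)) (Matrix.of c.2)
                (scatteringMatrix Z₀ B) =
              effectiveChannel Hd (fun k => Matrix.of (c.1 k)) (Matrix.of c.2)
                (scatteringMatrix Z₀ (symmetricOfEntries x)) := by
  by_cases hN : NI ≤ q + 1
  · refine Filter.Eventually.of_forall fun c Hd => Filter.Eventually.of_forall fun x => ?_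
    exact ⟨_, transpose_symmetricOfEntries x, by rw [bandMatrices_eq_univ hN]; trivial, rfl⟩
  have hq' : q + 1 = 2 * min (∑ k, Nr k) NT := by
    rw [channelDoF] at hq; omega
  -- The smaller side of the channel decides whether `H A⁻¹` or `A⁻¹ G` is preserved.
  rcases le_total (∑ k, Nr k) NT with h | h
  · have hcard : q + 1 = 2 * Fintype.card (Σ k : Fin K, Fin (Nr k)) := by
      rw [hq', min_eq_left h]; simp
    have : (volume : Measure (∀ k : Fin K, Fin (Nr k) → Fin NI → ℂ)).IsAddHaarMeasure :=
      isAddHaarMeasure_volume_pi _ fun _ => isAddHaarMeasure_volume_pi _ fun _ => inferInstance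
    have key : ∀ᵐ H : (∀ k : Fin K, Fin (Nr k) → Fin NI → ℂ), ∀ i, i + (q + 1) ≤ NI →
        WindowInjective (stack fun k => Matrix.of (H k)) i (q + 1) := by
      refine ae_forall_windowInjective hcard volume (fun a j x => ?_) fun Y =>
        ⟨fun k a j => Y ⟨k, a⟩ j, rfl⟩
      exact (ContinuousLinearMap.proj (R := ℝ) (φ := fun _ : Fin NI => ℂ) j ∘L
        ContinuousLinearMap.proj (φ := fun _ : Fin (Nr a.1) => Fin NI → ℂ) a.2 ∘L
        ContinuousLinearMap.proj (φ := fun k : Fin K => Fin (Nr k) → Fin NI → ℂ)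
          a.1).analyticAt x
    filter_upwards [Measure.quasiMeasurePreserving_fst.ae key] with c hc Hd
    filter_upwards [ae_exists_band hcard Z₀ _ hc] with x ⟨B', h1, h2, h3⟩
    exact ⟨B', h1, h2, effectiveChannel_congr _ _ _ _ (transpose_symmetricOfEntries x) h1
      (by rw [h3])⟩
  · have hcard : q + 1 = 2 * Fintype.card (Fin NT) := by
      rw [hq', min_eq_right h]; simp
    have : (volume : Measure (Fin NI → Fin NT → ℂ)).IsAddHaarMeasure :=
      isAddHaarMeasure_volume_pi _ fun _ => inferInstance
    have key : ∀ᵐ G : Fin NI → Fin NT → ℂ, ∀ i, i + (q + 1) ≤ NI →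
        WindowInjective (Matrix.of G)ᵀ i (q + 1) := by
      refine ae_forall_windowInjective hcard volume (fun a j x => ?_) fun Y =>
        ⟨fun j a => Y a j, rfl⟩
      refine ContDiffAt.analyticAt (ContDiff.contDiffAt ?_)
      simp only [Matrix.transpose_apply, Matrix.of_apply]
      fun_prop
    filter_upwards [Measure.quasiMeasurePreserving_snd.ae key] with c hc Hd
    filter_upwards [ae_exists_band hcard Z₀ _ hc] with x ⟨B', h1, h2, h3⟩
    refine ⟨B', h1, h2, effectiveChannel_congr _ _ _ _ (transpose_symmetricOfEntries x) h1 ?_⟩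
    -- Transposing turns `Gᵀ A⁻¹` into `A⁻¹ G`, as `A⁻¹` is symmetric.
    have h4 := congrArg Matrix.transpose h3
    rw [Matrix.transpose_mul, Matrix.transpose_mul, Matrix.transpose_transpose,
      inv_admittanceFactor_transpose Z₀ h1,
      inv_admittanceFactor_transpose Z₀ (transpose_symmetricOfEntries x)] at h4
    rw [Matrix.mul_assoc, h4, ← Matrix.mul_assoc]

/-! ### Density and the optimal value -/

theorem continuous_scatteringMatrix {N : ℕ} (Z₀ : ℝ) :
    Continuous fun x : Sym2 (Fin N) → ℝ => scatteringMatrix Z₀ (symmetricOfEntries x) := by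
  simp only [scatteringMatrix_eq Z₀ (transpose_symmetricOfEntries _), Matrix.inv_def,
    Ring.inverse_eq_inv']
  have h : Continuous fun x : Sym2 (Fin N) → ℝ => admittanceFactor Z₀ (symmetricOfEntries x) := by
    refine continuous_matrix fun a b => ?_
    simp only [admittanceFactor, symmetricOfEntries, Matrix.add_apply, Matrix.smul_apply,
      Matrix.map_apply, Matrix.of_apply, smul_eq_mul]
    fun_prop
  refine Continuous.sub (Continuous.const_smul (Continuous.smul (h.matrix_det.inv₀ fun x => ?_)
    h.matrix_adjugate) (2 : ℂ)) continuous_const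
  exact det_admittanceFactor_ne_zero Z₀ (transpose_symmetricOfEntries x)

theorem exists_symmetricOfEntries {N : ℕ} {B : Matrix (Fin N) (Fin N) ℝ} (hB : Bᵀ = B) :
    ∃ x, symmetricOfEntries x = B :=
  ⟨Sym2.lift ⟨fun a b => B a b, fun a b => congrFun (congrFun hB b) a⟩, rfl⟩

theorem optimalValue_eq_of_ae {K NT NI : ℕ} {Nr d : Fin K → ℕ} (Z₀ : ℝ)
    (Hd : ∀ k : Fin K, Matrix (Fin (Nr k)) (Fin NT) ℂ)
    (Hr : ∀ k : Fin K, Matrix (Fin (Nr k)) (Fin NI) ℂ)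
    (G : Matrix (Fin NI) (Fin NT) ℂ)
    (F : Matrix (Fin NT) (Σ k : Fin K, Fin (d k)) ℂ →
      Matrix (Σ k : Fin K, Fin (Nr k)) (Fin NT) ℂ → EReal)
    (𝒲 : Set (Matrix (Fin NT) (Σ k : Fin K, Fin (d k)) ℂ))
    (hF : LowerSemicontinuous fun H => ⨆ W ∈ 𝒲, F W H)
    (𝓑 : Set (Matrix (Fin NI) (Fin NI) ℝ))
    (h𝓑 : ∀ᵐ x : Sym2 (Fin NI) → ℝ, ∃ B : Matrix (Fin NI) (Fin NI) ℝ, Bᵀ = B ∧ B ∈ 𝓑 ∧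
      effectiveChannel Hd Hr G (scatteringMatrix Z₀ B) =
        effectiveChannel Hd Hr G (scatteringMatrix Z₀ (symmetricOfEntries x))) :
    optimalValue Z₀ Hd Hr G F 𝒲 𝓑 = optimalValue Z₀ Hd Hr G F 𝒲 Set.univ := by
  apply le_antisymm
  · refine sSup_le_sSup ?_
    rintro v ⟨W, Θ, B, h1, h2, -, h3⟩
    exact ⟨W, Θ, B, h1, h2, trivial, h3⟩
  refine sSup_le ?_
  rintro v ⟨W, Θ, B, rfl, hB, -, hW, rfl⟩
  -- Semicontinuity is available only for the supremum over `𝒲`, so the beamformer may change when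
  -- `B` is perturbed.
  refine (le_iSup₂ (f := fun W (_ : W ∈ 𝒲) =>
    F W (effectiveChannel Hd Hr G (scatteringMatrix Z₀ B))) W hW).trans ?_
  refine le_of_forall_lt fun y hy => ?_
  obtain ⟨x₀, rfl⟩ := exists_symmetricOfEntries hB
  have hc : Continuous fun x : Sym2 (Fin NI) → ℝ =>
      effectiveChannel Hd Hr G (scatteringMatrix Z₀ (symmetricOfEntries x)) := by
    simp only [effectiveChannel_eq]
    exact continuous_const.add ((continuous_const.matrix_mul
      (continuous_scatteringMatrix Z₀)).matrix_mul continuous_const)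
  have hopen := (hF.isOpen_preimage y).preimage hc
  obtain ⟨x, hx, B', h1, h2, h3⟩ := (Measure.dense_of_ae h𝓑).inter_open_nonempty _ hopen ⟨x₀, hy⟩
  refine lt_of_lt_of_le hx (iSup₂_le fun W hW => le_sSup ?_)
  exact ⟨W, _, B', rfl, h1, h2, hW, by rw [h3]⟩

/-! ### The step path graph -/

theorem susceptanceSet_stepPathGraph (N q : ℕ) :
    susceptanceSet (stepPathGraph N q) = bandMatrices N q := by
  ext B
  refine forall₂_congr fun n m => ?_
  simp only [stepPathGraph, not_and, not_le]
  constructor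
  · intro h hq
    have hne : n ≠ m := by rintro rfl; simp at hq; omega
    exact h hne fun _ => hq
  · intro h hne hq
    exact h (hq hne)

theorem rowSumCondition_stepPathGraph {N q : ℕ} {L : ℚ} (hq : (q : ℚ) = 2 * L - 1) :
    RowSumCondition L ((stepPathGraph N q).adjMatrix ℚ) := by
  intro n _
  -- Rows count from `0`: the later neighbours of `n` end at `n + q`, cut off at the last index `N -
  -- 1`.
  have hfilter : {m ∈ Finset.Ioi n | (stepPathGraph N q).Adj n m} =
      Finset.Ioc n (⟨min (n + q) (N - 1), by omega⟩ : Fin N) := by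
    ext m
    simp only [Finset.mem_filter, Finset.mem_Ioi, Finset.mem_Ioc, stepPathGraph, Fin.lt_def,
      Fin.le_def, abs_le, ne_eq, Fin.ext_iff]
    omega
  simp only [SimpleGraph.adjMatrix_apply]
  rw [Finset.sum_boole, hfilter, Fin.card_Ioc, ← hq,
    show (N : ℚ) - (n + 1) = ((N - (n + 1) : ℕ) : ℚ) by
      rw [Nat.cast_sub (by omega)]; push_cast; ring, ← Nat.cast_min]
  congr 1
  simp only
  omega

end BDRIS

/-- Band-connected RIS with band width `q = 2 L - 1` is optimal. -/
theorem mainTheorem3 (K NT NI : ℕ) (Nr : Fin K → ℕ) (Z₀ : ℝ)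
    (hK : 1 ≤ K) (hNT : 1 ≤ NT) (hNI : 1 ≤ NI) (hNr : ∀ k, 1 ≤ Nr k) (hZ₀ : 0 < Z₀)
    (q : ℕ) (hq : (q : ℚ) = 2 * BDRIS.archParam Nr NT NI - 1) :
    -- the architecture is the one of the `q`-step path graph, and the adjacency matrix of this
    -- graph satisfies the condition for optimality with `P = I`
    BDRIS.susceptanceSet (BDRIS.stepPathGraph NI q) = BDRIS.bandMatrices NI q ∧
    ((1 : Equiv.Perm (Fin NI)).permMatrix ℚ = 1 ∧
      BDRIS.AdjacencyCondition (BDRIS.archParam Nr NT NI)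
        ((BDRIS.stepPathGraph NI q).adjMatrix ℚ) 1) ∧
    -- almost every realization of the channels `H_r` and `G`, and every direct channel `H_d`
    ∀ᵐ c : (∀ k : Fin K, Fin (Nr k) → Fin NI → ℂ) × (Fin NI → Fin NT → ℂ) ∂volume,
      ∀ Hd : ∀ k : Fin K, Matrix (Fin (Nr k)) (Fin NT) ℂ,
        -- same optimal value, whenever the best utility `sup_{W ∈ 𝒲} F(W, H)` depends on the
        -- effective channel `H` lower semicontinuously (for example, `F(W, ·)` continuous)
        (∀ (d : Fin K → ℕ)
          (F : Matrix (Fin NT) (Σ k : Fin K, Fin (d k)) ℂ →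
            Matrix (Σ k : Fin K, Fin (Nr k)) (Fin NT) ℂ → EReal)
          (𝒲 : Set (Matrix (Fin NT) (Σ k : Fin K, Fin (d k)) ℂ)),
          LowerSemicontinuous (fun H => ⨆ W ∈ 𝒲, F W H) →
          BDRIS.optimalValue Z₀ Hd (fun k => Matrix.of (c.1 k)) (Matrix.of c.2) F 𝒲
              (BDRIS.bandMatrices NI q) =
            BDRIS.optimalValue Z₀ Hd (fun k => Matrix.of (c.1 k)) (Matrix.of c.2) F 𝒲
              Set.univ) ∧
        -- for arbitrary utilities: almost every fully-connected design has the same effective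
        -- channel as some band-connected design
        (∀ᵐ x : Sym2 (Fin NI) → ℝ ∂volume,
          ∃ B : Matrix (Fin NI) (Fin NI) ℝ, Bᵀ = B ∧ B ∈ BDRIS.bandMatrices NI q ∧
            BDRIS.effectiveChannel Hd (fun k => Matrix.of (c.1 k)) (Matrix.of c.2)
                (BDRIS.scatteringMatrix Z₀ B) =
              BDRIS.effectiveChannel Hd (fun k => Matrix.of (c.1 k)) (Matrix.of c.2)
                (BDRIS.scatteringMatrix Z₀ (BDRIS.symmetricOfEntries x))) := by
  refine ⟨BDRIS.susceptanceSet_stepPathGraph NI q, ⟨Matrix.permMatrix_one,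
    (BDRIS.stepPathGraph NI q).adjMatrix ℚ, by simp,
    BDRIS.rowSumCondition_stepPathGraph hq⟩, ?_⟩
  -- This is `q + 1 = 2L` with the rational minimum cleared of its half.
  have hq' : q + 1 = min (2 * BDRIS.channelDoF Nr NT) NI := by
    have h : (q : ℚ) + 1 = min (2 * (BDRIS.channelDoF Nr NT : ℚ)) NI := by
      rw [hq, BDRIS.archParam, sub_add_cancel, mul_min_of_nonneg _ _ zero_le_two]
      congr 1
      ring
    exact_mod_cast h
  filter_upwards [BDRIS.ae_exists_band_effectiveChannel K NT NI Nr Z₀ q hq'] with c hc Hd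
  exact ⟨fun d F 𝒲 hF => BDRIS.optimalValue_eq_of_ae Z₀ Hd _ _ F 𝒲 hF _ (hc Hd), hc Hd⟩
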